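/- For a finite Markov chain with transition matrix $P$ that has a unique stationary distribution $\pi$, let $m_{ij}$ be the expected value of the first time $t\ge 0$ at which the chain started at $i$ is at $j$ (so $m_{ii}=0$). If $\sum_j \pi_j m_{ij}$ is finite and does not depend on $i$, its value is called Kemeny's constant of the chain. Kemeny's constant $\mathscr{K}(G)$ of a finite connected simple graph $G$ is Kemeny's constant of the simple random walk on $G$, which at each step moves to a uniformly chosen neighbour of the current vertex (on the one-vertex graph the walk stays put, so that $\mathscr{K}=0$). Theorem. Among all trees on $n\ge 1$ vertices, the path has the largest Kemeny's constant: the path $P_n$ on $n$ vertices is a tree, and for every tree $T$ on $n$ vertices, $\mathscr{K}(T)$ and $\mathscr{K}(P_n)$ are well defined and $$\mathscr{K}(T)\le \mathscr{K}(P_n).$$ -/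

import Mathlib

open MeasureTheory ProbabilityTheory Finset
open scoped ENNReal

noncomputable section

namespace Kemeny

universe u

section Chain

variable {V : Type u}

/-- The transition kernels, in the form needed for the Ionescu-Tulcea theorem, of the
time-homogeneous Markov chain on the discrete space `V` with transition probabilities `P`: given
the history up to time `n`, the state at time `n + 1` has law `P x`, where `x` is the state at
time `n`. -/
def stepKernel [MeasurableSpace V] [DiscreteMeasurableSpace V] (P : V → PMF V) (n : ℕ) :
    Kernel ((_ : Iic n) → V) V where
  toFun history := (P (history ⟨n, mem_Iic.2 le_rfl⟩)).toMeasure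
  measurable' :=
    (Measurable.of_discrete (f := fun x : V => (P x).toMeasure)).comp (measurable_pi_apply _)

instance instIsMarkovKernelStepKernel [MeasurableSpace V] [DiscreteMeasurableSpace V] (P : V → PMF V) (n : ℕ) :
    IsMarkovKernel (stepKernel P n) :=
  ⟨fun history => PMF.toMeasure.isProbabilityMeasure (P (history ⟨n, mem_Iic.2 le_rfl⟩))⟩

/-- The law, on the space of infinite trajectories `X₀, X₁, X₂, …`, of the Markov chain with
transition probabilities `P` and initial state `i`. -/
def chainLaw [MeasurableSpace V] [DiscreteMeasurableSpace V] (P : V → PMF V) (i : V) :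
    Measure (ℕ → V) :=
  Kernel.traj (X := fun _ => V) (stepKernel P) 0 (fun _ => i)

/-- The first time `t ≥ 0` at which the trajectory `ω` is at `j` (`∞` if there is none). -/
def firstHit (j : V) (ω : ℕ → V) : ℝ≥0∞ :=
  ⨅ (t : ℕ) (_ : ω t = j), (t : ℝ≥0∞)

/-- The hitting time `m i j`: the expected first time at which the chain started at `i` is
at `j`. -/
def hittingTime (P : V → PMF V) (i j : V) : ℝ≥0∞ :=
  letI : MeasurableSpace V := ⊤
  ∫⁻ ω, firstHit j ω ∂(chainLaw P i)

/-- `π` is a stationary distribution of the chain: `π P = π`. -/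
def IsStationary (P : V → PMF V) (π : PMF V) : Prop :=
  π.bind P = π

/-- Kemeny's constant of the chain `P` on a finite state space is well defined and equal to the
real number `c`: the chain has exactly one stationary distribution `π`, and
`∑ j, π j * m i j = c` for every initial state `i`. -/
def HasKemenyConstant [Fintype V] (P : V → PMF V) (c : ℝ) : Prop :=
  ∃ π : PMF V, IsStationary P π ∧ (∀ π' : PMF V, IsStationary P π' → π' = π) ∧
    0 ≤ c ∧ ∀ i : V, ∑ j : V, π j * hittingTime P i j = ENNReal.ofReal c

end Chain

section Graph

variable {V : Type u} [Fintype V]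

open scoped Classical in
/-- The simple random walk on `G`: from `v`, move to a uniformly chosen neighbour of `v` (and stay
at `v` if it has no neighbour, which in a connected graph only happens when `v` is the only
vertex). -/
def randomWalk (G : SimpleGraph V) (v : V) : PMF V :=
  if h : (G.neighborFinset v).Nonempty then PMF.uniformOfFinset (G.neighborFinset v) h
  else PMF.pure v

/-- Kemeny's constant of the graph `G` is well defined and equal to `c`. -/
def HasGraphKemenyConstant (G : SimpleGraph V) (c : ℝ) : Prop :=
  HasKemenyConstant (randomWalk G) c

end Graph

end Kemeny

end

/-! On a tree everything is explicit. The stationary law is `deg / (2(n-1))`, and `treeHittingTime`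
solves the first-step equations for hitting times. Averaging it over the target gives `𝒦(T) =
W/(n-1) - (2n-1)/2`, where `W` sums the distances over ordered pairs
(`hasGraphKemenyConstant_of_isTree`). So `𝒦` increases with `W`, and the path has the largest `W`
among connected graphs on `n` vertices: `sum_sum_dist_le` removes one non-cut vertex at a time, and
`le_sum_sum_dist_pathGraph` shows that the path reaches the bound. The link to the trajectory
measure is `lintegral_firstHit`: a finite solution of the first-step equations is the expected
hitting time. -/

namespace Kemeny

/-! ### Hitting times from first-step equations -/

section HittingTime

variable {V : Type*}

open Classical in
/-- The indicator of the event that the trajectory avoids `j` up to time `n`. -/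
noncomputable def avoids (j : V) (n : ℕ) (ω : ℕ → V) : ℝ≥0∞ :=
  if ∀ t ≤ n, ω t ≠ j then 1 else 0

lemma avoids_succ_mul (j : V) (n : ℕ) (ω : ℕ → V) {h : V → ℝ≥0∞} (hj : h j = 0) :
    avoids j (n + 1) ω * h (ω (n + 1)) = avoids j n ω * h (ω (n + 1)) := by
  classical
  by_cases hω : ω (n + 1) = j
  · simp [hω, hj]
  · have : (∀ t ≤ n + 1, ω t ≠ j) ↔ ∀ t ≤ n, ω t ≠ j := by
      refine ⟨fun H t ht => H t (by lia), fun H t ht => ?_⟩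
      rcases Nat.lt_or_eq_of_le ht with h' | rfl
      · exact H t (by lia)
      · exact hω
    unfold avoids
    congr 1
    exact if_congr this rfl rfl

lemma firstHit_eq_tsum (j : V) (ω : ℕ → V) : firstHit j ω = ∑' n, avoids j n ω := by
  classical
  by_cases hex : ∃ t, ω t = j
  · have hav : ∀ n, avoids j n ω = if n ∈ range (Nat.find hex) then 1 else 0 := by
      intro n
      simp only [avoids, mem_range, Nat.lt_find_iff]
    have h1 : firstHit j ω = (Nat.find hex : ℕ) := by
      refine le_antisymm (iInf₂_le (Nat.find hex) (Nat.find_spec hex)) (le_iInf₂ fun t ht => ?_)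
      exact_mod_cast Nat.find_min' hex ht
    rw [h1, tsum_eq_sum (s := range (Nat.find hex)) (fun b hb => by rw [hav, if_neg hb]),
      sum_congr rfl fun n hn => by rw [hav, if_pos hn]]
    simp
  · push Not at hex
    have hav : ∀ n, avoids j n ω = 1 := fun n => if_pos fun t _ => hex t
    simp [hav, firstHit, hex]

variable [MeasurableSpace V] [DiscreteMeasurableSpace V]

lemma lintegral_chainLaw_zero (P : V → PMF V) (i : V) (h : V → ℝ≥0∞) :
    ∫⁻ ω, h (ω 0) ∂chainLaw P i = h i := by
  have hm := Kernel.traj_map_frestrictLe_apply (X := fun _ => V) (κ := stepKernel P) 0 0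
    (fun _ => i)
  rw [Kernel.partialTraj_self, Kernel.id_apply] at hm
  have hmeas : Measurable fun x : (_ : Iic 0) → V => h (x ⟨0, mem_Iic.2 le_rfl⟩) :=
    (Measurable.of_discrete (f := h)).comp (measurable_pi_apply _)
  calc ∫⁻ ω, h (ω 0) ∂chainLaw P i
      = ∫⁻ x, h (x ⟨0, mem_Iic.2 le_rfl⟩) ∂((chainLaw P i).map (Preorder.frestrictLe 0)) := by
        rw [lintegral_map hmeas (by fun_prop)]; rfl
    _ = h i := by rw [chainLaw, hm, lintegral_dirac' _ hmeas]

/-- The Markov property: `F` is an arbitrary function of the past up to time `n`. -/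
lemma lintegral_chainLaw_succ [Fintype V] (P : V → PMF V) (i : V) (n : ℕ)
    (F : ((_ : Iic n) → V) → ℝ≥0∞) (h : V → ℝ≥0∞) :
    ∫⁻ ω, F (Preorder.frestrictLe n ω) * h (ω (n + 1)) ∂chainLaw P i =
      ∫⁻ ω, F (Preorder.frestrictLe n ω) * ∑ k, P (ω n) k * h k ∂chainLaw P i := by
  have hF : Measurable F := Measurable.of_discrete
  have hh : Measurable h := Measurable.of_discrete
  have h1 := Kernel.partialTraj_compProd_eq_map_traj (X := fun _ => V) (κ := stepKernel P)
    (Nat.zero_le n) (x₀ := fun _ => i)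
  have h2 := Kernel.traj_map_frestrictLe_apply (X := fun _ => V) (κ := stepKernel P) 0 n
    (fun _ => i)
  have hG : Measurable fun p : ((_ : Iic n) → V) × V => F p.1 * h p.2 := by fun_prop
  have hS : Measurable fun x : (_ : Iic n) → V =>
    F x * ∑ k, P (x ⟨n, mem_Iic.2 le_rfl⟩) k * h k := Measurable.of_discrete
  calc ∫⁻ ω, F (Preorder.frestrictLe n ω) * h (ω (n + 1)) ∂chainLaw P i
      = ∫⁻ p, F p.1 * h p.2 ∂((chainLaw P i).map
          (fun x => (Preorder.frestrictLe n x, x (n + 1)))) := by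
        rw [lintegral_map hG (by fun_prop)]
    _ = ∫⁻ x, F x * ∑ k, P (x ⟨n, mem_Iic.2 le_rfl⟩) k * h k
          ∂(Kernel.partialTraj (X := fun _ => V) (stepKernel P) 0 n (fun _ => i)) := by
        rw [chainLaw, ← h1, Measure.lintegral_compProd hG]
        refine lintegral_congr fun x => ?_
        dsimp only
        rw [lintegral_const_mul _ hh]
        congr 1
        change ∫⁻ k, h k ∂(P _).toMeasure = _
        rw [lintegral_fintype]
        refine sum_congr rfl fun k _ => ?_
        rw [PMF.toMeasure_apply_singleton _ _ (measurableSet_singleton k), mul_comm]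
    _ = _ := by
        rw [← h2, lintegral_map hS (by fun_prop)]
        rfl

lemma measurable_avoids (j : V) (n : ℕ) : Measurable (avoids j n) := by
  unfold avoids
  refine Measurable.ite ?_ measurable_const measurable_const
  simp only [Set.ofPred_forall]
  exact MeasurableSet.iInter fun t => MeasurableSet.iInter fun _ =>
    (measurable_pi_apply (X := fun _ => V) t) (MeasurableSet.of_discrete (s := {x : V | x ≠ j}))

lemma lintegral_avoids_mul [Fintype V] {P : V → PMF V} {j : V} {h : V → ℝ≥0∞} (hj : h j = 0)
    (hP : ∀ i, i ≠ j → h i = 1 + ∑ k, P i k * h k) (i : V) (n : ℕ) :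
    ∫⁻ ω, avoids j n ω * h (ω n) ∂chainLaw P i =
      ∫⁻ ω, avoids j n ω ∂chainLaw P i +
        ∫⁻ ω, avoids j (n + 1) ω * h (ω (n + 1)) ∂chainLaw P i := by
  classical
  simp only [avoids_succ_mul j n _ hj]
  have hF : ∀ ω : ℕ → V, avoids j n ω =
      (fun x : (_ : Iic n) → V => if ∀ t, x t ≠ j then (1 : ℝ≥0∞) else 0)
        (Preorder.frestrictLe n ω) := by
    intro ω
    simp [avoids, Preorder.frestrictLe]
  have hsucc := lintegral_chainLaw_succ P i n
    (fun x : (_ : Iic n) → V => if ∀ t, x t ≠ j then (1 : ℝ≥0∞) else 0) h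
  simp only [← hF] at hsucc
  rw [hsucc, ← lintegral_add_left (measurable_avoids j n)]
  refine lintegral_congr fun ω => ?_
  by_cases hω : ∀ t ≤ n, ω t ≠ j
  · rw [avoids, if_pos hω, hP _ (hω n le_rfl)]
    ring
  · simp [avoids, if_neg hω]

/-- Iterating the first-step equation telescopes `h i` into the tail sum for the hitting time plus a
remainder `a N`. Finiteness of `h` makes the tail sum converge, so its terms tend to 0, and they
control the remainder. -/
lemma lintegral_firstHit [Fintype V] {P : V → PMF V} {j : V} {h : V → ℝ≥0∞} (hj : h j = 0)
    (hP : ∀ i, i ≠ j → h i = 1 + ∑ k, P i k * h k) (htop : ∀ i, h i ≠ ∞) (i : V) :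
    ∫⁻ ω, firstHit j ω ∂chainLaw P i = h i := by
  set s : ℕ → ℝ≥0∞ := fun n => ∫⁻ ω, avoids j n ω ∂chainLaw P i
  set a : ℕ → ℝ≥0∞ := fun n => ∫⁻ ω, avoids j n ω * h (ω n) ∂chainLaw P i
  have hstep : ∀ n, a n = s n + a (n + 1) := lintegral_avoids_mul hj hP i
  have h0 : a 0 = h i := by
    rw [← lintegral_chainLaw_zero P i h]
    refine lintegral_congr fun ω => ?_
    by_cases hω : ω 0 = j
    · simp [hω, hj]
    · simp [avoids, hω]
  have hsum : ∀ N, ∑ n ∈ range N, s n + a N = h i := by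
    intro N
    induction N with
    | zero => simpa using h0
    | succ N ih => rw [sum_range_succ, add_assoc, ← hstep, ih]
  have hle : ∑' n, s n ≤ h i := ENNReal.tsum_le_of_sum_range_le fun N =>
    le_self_add.trans_eq (hsum N)
  have hs : Filter.Tendsto s Filter.atTop (nhds 0) :=
    ENNReal.tendsto_atTop_zero_of_tsum_ne_top (ne_top_of_le_ne_top (htop i) hle)
  have hC : ∑ k, h k ≠ ∞ := ENNReal.sum_ne_top.2 fun k _ => htop k
  have hale : ∀ n, a n ≤ s n * ∑ k, h k := fun n => by
    rw [← lintegral_mul_const _ (measurable_avoids j n)]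
    refine lintegral_mono fun ω => ?_
    gcongr
    exact single_le_sum (f := h) (fun _ _ => zero_le) (mem_univ (ω n))
  have ha : Filter.Tendsto a Filter.atTop (nhds 0) := by
    refine tendsto_of_tendsto_of_tendsto_of_le_of_le tendsto_const_nhds ?_
      (fun _ => zero_le) hale
    simpa using ENNReal.Tendsto.mul_const hs (Or.inr hC)
  have hlim := (ENNReal.tendsto_nat_tsum s).add ha
  simp only [hsum, add_zero] at hlim
  simp only [firstHit_eq_tsum]
  rw [lintegral_tsum fun n => (measurable_avoids j n).aemeasurable]
  exact (tendsto_nhds_unique tendsto_const_nhds hlim).symm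

end HittingTime

/-! ### A criterion in real numbers -/

section Criterion

variable {V : Type*} [Fintype V]

lemma hittingTime_eq_ofReal {P : V → PMF V} {j : V} {h : V → ℝ} (h0 : ∀ i, 0 ≤ h i)
    (hj : h j = 0) (hP : ∀ i, i ≠ j → h i = 1 + ∑ k, (P i k).toReal * h k) (i : V) :
    hittingTime P i j = ENNReal.ofReal (h i) := by
  let _ : MeasurableSpace V := ⊤
  refine lintegral_firstHit (h := fun i => ENNReal.ofReal (h i)) (by simp [hj])
    (fun i hi => ?_) (fun _ => ENNReal.ofReal_ne_top) i
  have hnn : ∀ k ∈ (univ : Finset V), 0 ≤ (P i k).toReal * h k :=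
    fun k _ => mul_nonneg ENNReal.toReal_nonneg (h0 k)
  rw [hP i hi, ENNReal.ofReal_add zero_le_one (sum_nonneg hnn), ENNReal.ofReal_one,
    ENNReal.ofReal_sum_of_nonneg hnn]
  congr 1
  refine sum_congr rfl fun k _ => ?_
  rw [ENNReal.ofReal_mul ENNReal.toReal_nonneg, ENNReal.ofReal_toReal ((P i).apply_ne_top k)]

lemma isStationary_iff (P : V → PMF V) (π : PMF V) :
    IsStationary P π ↔ ∀ k, ∑ i, (π i).toReal * (P i k).toReal = (π k).toReal := by
  rw [IsStationary, PMF.ext_iff]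
  refine forall_congr' fun k => ?_
  rw [PMF.bind_apply, tsum_fintype]
  have hne : ∀ i ∈ (univ : Finset V), π i * P i k ≠ ∞ := fun i _ =>
    ENNReal.mul_ne_top (π.apply_ne_top i) ((P i).apply_ne_top k)
  rw [← ENNReal.toReal_eq_toReal_iff' (ENNReal.sum_ne_top.2 hne) (π.apply_ne_top k),
    ENNReal.toReal_sum hne]
  simp only [ENNReal.toReal_mul]

/-- Kac's formula: a stationary distribution is determined by the expected return times. -/
lemma stationary_mul_returnTime {P : V → PMF V} {π : V → ℝ} (hsum : ∑ i, π i = 1)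
    (hπ : ∀ k, ∑ i, π i * (P i k).toReal = π k) {j : V} {h : V → ℝ} (hj : h j = 0)
    (hP : ∀ i, i ≠ j → h i = 1 + ∑ k, (P i k).toReal * h k) :
    π j * (1 + ∑ k, (P j k).toReal * h k) = 1 := by
  classical
  have h1 : ∑ i, π i * ∑ k, (P i k).toReal * h k = ∑ i, π i * h i := by
    simp only [mul_sum]
    rw [sum_comm]
    refine sum_congr rfl fun k _ => ?_
    rw [← hπ k, sum_mul]
    exact sum_congr rfl fun i _ => by ring
  -- By stationarity `Ph - h` has `π`-mean 0; only the term `i = j` will survive.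
  have h2 : ∑ i, π i * (1 + ∑ k, (P i k).toReal * h k - h i) = 1 := by
    simp only [mul_sub, mul_add, sum_sub_distrib, sum_add_distrib, h1, mul_one, hsum]
    ring
  rw [sum_eq_single j (fun i _ hi => by rw [← hP i hi]; ring) (by simp)] at h2
  simpa [hj] using h2

/-- Irreducibility is not needed: the return times computed from `H` already force uniqueness of
`π`. -/
lemma hasKemenyConstant_of_real {P : V → PMF V} {π : V → ℝ} {H : V → V → ℝ} {c : ℝ}
    (hπ0 : ∀ i, 0 ≤ π i) (hπ1 : ∑ i, π i = 1)
    (hπ : ∀ k, ∑ i, π i * (P i k).toReal = π k)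
    (hH0 : ∀ i j, 0 ≤ H i j) (hHj : ∀ j, H j j = 0)
    (hP : ∀ i j, i ≠ j → H i j = 1 + ∑ k, (P i k).toReal * H k j) (hc0 : 0 ≤ c)
    (hc : ∀ i, ∑ j, π j * H i j = c) : HasKemenyConstant P c := by
  have hone : ∑ i, ENNReal.ofReal (π i) = 1 := by
    rw [← ENNReal.ofReal_sum_of_nonneg fun i _ => hπ0 i, hπ1, ENNReal.ofReal_one]
  refine ⟨PMF.ofFintype _ hone, ?_, fun π' hπ' => ?_, hc0, fun i => ?_⟩
  · rw [isStationary_iff]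
    simpa [ENNReal.toReal_ofReal, hπ0] using hπ
  · rw [isStationary_iff] at hπ'
    have hs' : ∑ i, (π' i).toReal = 1 := by
      rw [← ENNReal.toReal_sum fun i _ => π'.apply_ne_top i, ← tsum_fintype (L := .unconditional _),
        π'.tsum_coe, ENNReal.toReal_one]
    ext j
    have e1 := stationary_mul_returnTime hπ1 hπ (h := fun k => H k j) (hHj j) (fun i hi => hP i j hi)
    have e2 := stationary_mul_returnTime hs' hπ' (h := fun k => H k j) (hHj j) (fun i hi => hP i j hi)
    have hne : 1 + ∑ k, (P j k).toReal * H k j ≠ 0 := fun h => by simp [h] at e1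
    rw [PMF.ofFintype_apply, ← ENNReal.ofReal_toReal (π'.apply_ne_top j),
      mul_right_cancel₀ hne (e2.trans e1.symm)]
  · have hh : ∀ j, hittingTime P i j = ENNReal.ofReal (H i j) := fun j =>
      hittingTime_eq_ofReal (h := fun k => H k j) (fun k => hH0 k j) (hHj j)
        (fun k hk => hP k j hk) i
    rw [← hc i, ENNReal.ofReal_sum_of_nonneg fun j _ => mul_nonneg (hπ0 j) (hH0 i j)]
    refine sum_congr rfl fun j _ => ?_
    rw [hh, PMF.ofFintype_apply, ENNReal.ofReal_mul (hπ0 j)]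

end Criterion

/-! ### Simple random walk -/

section RandomWalk

variable {V : Type*} [Fintype V] (G : SimpleGraph V) [DecidableRel G.Adj]

lemma sum_sum_neighborFinset (g f : V → ℝ) :
    ∑ k, g k * ∑ l ∈ G.neighborFinset k, f l = ∑ k, f k * ∑ l ∈ G.neighborFinset k, g l := by
  simp only [mul_sum, G.neighborFinset_eq_filter, sum_filter]
  rw [sum_comm]
  refine sum_congr rfl fun l _ => sum_congr rfl fun k _ => ?_
  simp only [G.adj_comm k l]
  split_ifs <;> ring

variable {G}

lemma sum_randomWalk_mul {i : V} (hi : 0 < G.degree i) (f : V → ℝ) :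
    ∑ k, (randomWalk G i k).toReal * f k = (∑ k ∈ G.neighborFinset i, f k) / G.degree i := by
  classical
  have hne : (G.neighborFinset i).Nonempty := card_pos.1 hi
  have hw : ∀ k, (randomWalk G i k).toReal =
      if k ∈ G.neighborFinset i then (G.degree i : ℝ)⁻¹ else 0 := by
    intro k
    have h' := hne
    rw [randomWalk, dif_pos (by convert hne), PMF.uniformOfFinset_apply]
    simp only [SimpleGraph.mem_neighborFinset, SimpleGraph.card_neighborFinset_eq_degree]
    split_ifs
    · rw [ENNReal.toReal_inv, ENNReal.toReal_natCast]
      congr!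
    · simp
  simp only [hw, ite_mul, zero_mul, sum_ite_mem, univ_inter, ← mul_sum]
  rw [div_eq_inv_mul]

end RandomWalk

/-! ### Degree and distance identities on trees -/

section Tree

variable {V : Type*} {T : SimpleGraph V}

lemma existsUnique_adj_dist_add_one_eq (hT : T.IsTree) {i j : V} (hij : i ≠ j) :
    ∃! l, T.Adj i l ∧ T.dist l j + 1 = T.dist i j := by
  obtain ⟨p, hp, hlen⟩ := hT.connected.exists_path_of_dist i j
  cases p with
  | nil => exact absurd rfl hij
  | @cons _ l _ hadj p =>
    rw [SimpleGraph.Walk.length_cons] at hlen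
    refine ⟨l, ⟨hadj, ?_⟩, fun l' ⟨hadj', hl'⟩ => ?_⟩
    · have h1 := SimpleGraph.dist_le p
      rcases hT.dist_eq_dist_add_one_of_adj j hadj with h | h <;>
        simp only [SimpleGraph.dist_comm (u := j)] at h <;> lia
    · obtain ⟨q, hq⟩ := hT.connected.exists_walk_length_eq_dist l' j
      have hq' : (SimpleGraph.Walk.cons hadj' q).IsPath :=
        SimpleGraph.Walk.isPath_of_length_eq_dist _ (by simp [hq, hl'])
      have heq := (hT.existsUnique_path i j).unique hq' hp
      simpa using congrArg SimpleGraph.Walk.snd heq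

variable [Fintype V] [DecidableRel T.Adj]

/-- Exactly one neighbour of `i` is closer to `j`; all others are one step farther. -/
lemma sum_neighborFinset_dist (hT : T.IsTree) (φ : ℕ → ℝ) {i j : V} (hij : i ≠ j) :
    ∑ l ∈ T.neighborFinset i, φ (T.dist l j) =
      φ (T.dist i j - 1) + (T.degree i - 1) * φ (T.dist i j + 1) := by
  classical
  obtain ⟨l, ⟨hadj, hl⟩, huniq⟩ := existsUnique_adj_dist_add_one_eq hT hij
  have hmem : l ∈ T.neighborFinset i := by simpa using hadj
  rw [← add_sum_erase _ _ hmem, ← hl, Nat.add_sub_cancel]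
  congr 1
  rw [sum_congr rfl (g := fun _ => φ (T.dist l j + 1 + 1)), sum_const, card_erase_of_mem hmem,
    SimpleGraph.card_neighborFinset_eq_degree, nsmul_eq_mul, Nat.cast_pred]
  · exact (T.degree_pos_iff_exists_adj i).2 ⟨l, hadj⟩
  · intro l' hl'
    rw [mem_erase, SimpleGraph.mem_neighborFinset] at hl'
    have hne : T.dist l' j + 1 ≠ T.dist i j := fun h => hl'.1 (huniq l' ⟨hl'.2, h⟩)
    have hcases := hT.dist_eq_dist_add_one_of_adj j hl'.2
    simp only [SimpleGraph.dist_comm (u := j)] at hcases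
    congr 1
    lia

lemma sum_neighborFinset_dist_self (φ : ℕ → ℝ) (j : V) :
    ∑ l ∈ T.neighborFinset j, φ (T.dist l j) = T.degree j * φ 1 := by
  rw [sum_congr rfl (g := fun _ => φ 1), sum_const, SimpleGraph.card_neighborFinset_eq_degree,
    nsmul_eq_mul]
  intro l hl
  rw [SimpleGraph.dist_eq_one_iff_adj.2 ((T.mem_neighborFinset j l).1 hl).symm]

open Classical in
lemma sum_neighborFinset_dist_cast (hT : T.IsTree) (i j : V) :
    ∑ l ∈ T.neighborFinset i, (T.dist l j : ℝ) =
      T.degree i * T.dist i j + T.degree i - 2 + if j = i then 2 else 0 := by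
  by_cases hij : i = j
  · subst hij
    rw [sum_neighborFinset_dist_self (fun n => (n : ℝ))]
    simp
  · rw [sum_neighborFinset_dist hT (fun n => (n : ℝ)) hij, if_neg (Ne.symm hij),
      Nat.cast_pred (hT.connected.pos_dist_of_ne hij)]
    push_cast
    ring

lemma sum_degree_cast (hT : T.IsTree) :
    ∑ k, (T.degree k : ℝ) = 2 * (Fintype.card V - 1) := by
  have h1 := T.sum_degrees_eq_twice_card_edges
  have h2 := hT.card_edgeFinset
  rw [← h2]
  push_cast
  rw [add_sub_cancel_right]
  exact_mod_cast h1

lemma sum_degree_mul_dist (hT : T.IsTree) (j : V) :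
    ∑ k, (T.degree k : ℝ) * T.dist k j = 2 * ∑ k, (T.dist k j : ℝ) - (Fintype.card V - 1) := by
  -- Squared distance is the test function because its neighbour sum differs from `deg * dist ^ 2`
  -- by terms linear in the distance.
  have h1 := sum_sum_neighborFinset T (fun _ => 1) (fun l => (T.dist l j : ℝ) ^ 2)
  have h2 : ∀ k, ∑ l ∈ T.neighborFinset k, (T.dist l j : ℝ) ^ 2 =
      T.degree k * T.dist k j ^ 2 + 2 * (T.degree k * T.dist k j) + T.degree k
        - 4 * T.dist k j := by
    intro k
    by_cases hk : k = j
    · subst hk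
      rw [sum_neighborFinset_dist_self (fun n => (n : ℝ) ^ 2)]
      simp
    · rw [sum_neighborFinset_dist hT (fun n => (n : ℝ) ^ 2) hk,
        Nat.cast_pred (hT.connected.pos_dist_of_ne hk)]
      push_cast
      ring
  simp only [h2, one_mul, sum_const, SimpleGraph.card_neighborFinset_eq_degree, nsmul_eq_mul,
    mul_one, sum_add_distrib, sum_sub_distrib, ← mul_sum, sum_degree_cast hT,
    mul_comm _ ((T.dist _ j : ℝ) ^ 2)] at h1
  linarith

lemma sum_degree_mul_degree_mul_dist (hT : T.IsTree) :
    ∑ j, ∑ k, (T.degree j : ℝ) * (T.degree k * T.dist k j) =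
      4 * ∑ j, ∑ k, (T.dist k j : ℝ) -
        2 * (Fintype.card V - 1) * (2 * Fintype.card V - 1) := by
  have h : ∑ j, (T.degree j : ℝ) * ∑ k, (T.dist k j : ℝ) =
      2 * ∑ j, ∑ k, (T.dist k j : ℝ) - Fintype.card V * (Fintype.card V - 1) := by
    calc ∑ j, (T.degree j : ℝ) * ∑ k, (T.dist k j : ℝ)
        = ∑ k, ∑ j, (T.degree j : ℝ) * T.dist j k := by
          simp only [mul_sum]
          rw [sum_comm]
          exact sum_congr rfl fun k _ => sum_congr rfl fun j _ => by rw [T.dist_comm]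
      _ = _ := by
          simp only [sum_degree_mul_dist hT, sum_sub_distrib, ← mul_sum, sum_const, card_univ,
            nsmul_eq_mul]
          ring
  simp only [← mul_sum, sum_degree_mul_dist hT, mul_sub, sum_sub_distrib, ← sum_mul,
    sum_degree_cast hT]
  simp only [mul_left_comm _ (2 : ℝ), ← mul_sum, h]
  ring

end Tree

/-! ### Maximal total distance in a connected graph -/

section Distance

variable {V : Type*} {G : SimpleGraph V}

lemma exists_dist_eq_of_le (hG : G.Connected) {v u : V} {t : ℕ} (ht : t ≤ G.dist v u) :
    ∃ w, G.dist v w = t := by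
  obtain ⟨p, hp⟩ := hG.exists_walk_length_eq_dist v u
  refine ⟨p.getVert t, ?_⟩
  rw [← SimpleGraph.length_eq_dist_of_subwalk hp (p.isSubwalk_take t), p.take_length,
    min_eq_left (hp ▸ ht)]

lemma dist_le_dist_induce {s : Set V} (hs : (G.induce s).Connected) (u v : s) :
    G.dist u v ≤ (G.induce s).dist u v := by
  obtain ⟨p, hp⟩ := hs.exists_walk_length_eq_dist u v
  rw [← hp, ← p.length_map (SimpleGraph.Embedding.induce s).toHom]
  exact SimpleGraph.dist_le _

variable [Fintype V]

/-- A geodesic to a vertex beyond distance `t` meets each distance `0, …, t`, so at least `t + 1`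
vertices are excluded. -/
lemma card_lt_dist_le (hG : G.Connected) (v : V) (t : ℕ) :
    #{u | t < G.dist v u} ≤ Fintype.card V - 1 - t := by
  classical
  rcases Finset.eq_empty_or_nonempty ({u | t < G.dist v u} : Finset V) with h | ⟨u, hu⟩
  · simp [h]
  · have hsub : range (t + 1) ⊆ ({u | ¬ t < G.dist v u} : Finset V).image (G.dist v) := by
      intro s hs
      rw [mem_range] at hs
      obtain ⟨w, hw⟩ := exists_dist_eq_of_le hG (v := v) (u := u) (t := s)
        (by have := (mem_filter.1 hu).2; lia)
      exact mem_image.2 ⟨w, mem_filter.2 ⟨mem_univ _, by lia⟩, hw⟩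
    have h1 := (card_le_card hsub).trans card_image_le
    have h2 := card_filter_add_card_filter_not (s := (univ : Finset V)) (fun u => t < G.dist v u)
    rw [card_range] at h1
    rw [card_univ] at h2
    lia

lemma two_mul_sum_dist_le (hG : G.Connected) (v : V) :
    2 * ∑ u, G.dist v u ≤ Fintype.card V * (Fintype.card V - 1) := by
  have hdist : ∀ u, G.dist v u = ∑ t ∈ range (Fintype.card V), if t < G.dist v u then 1 else 0 := by
    intro u
    obtain ⟨p, hp, hlen⟩ := hG.exists_path_of_dist v u
    have hlt := hp.length_lt
    rw [← card_filter, show ({t ∈ range (Fintype.card V) | t < G.dist v u}) =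
      range (G.dist v u) by ext t; simp; lia, card_range]
  have hle : ∑ u, G.dist v u ≤ ∑ t ∈ range (Fintype.card V), id t := by
    rw [sum_congr rfl fun u _ => hdist u, sum_comm, ← sum_range_reflect id]
    refine sum_le_sum fun t _ => ?_
    rw [← card_filter]
    exact card_lt_dist_le hG v t
  calc 2 * ∑ u, G.dist v u ≤ (∑ t ∈ range (Fintype.card V), t) * 2 := by
        rw [mul_comm]; exact Nat.mul_le_mul_right 2 hle
    _ = _ := sum_range_id_mul_two _

end Distance

lemma sum_sum_dist_le (n : ℕ) : ∀ {V : Type*} [Fintype V] {G : SimpleGraph V}, G.Connected →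
    Fintype.card V = n → ∑ u, ∑ v, G.dist u v ≤ ∑ m ∈ range n, m * (m + 1) := by
  induction n with
  | zero =>
    intro V _ G hG hV
    have := Fintype.card_eq_zero_iff.1 hV
    simp
  | succ n ih =>
    intro V _ G hG hV
    classical
    rcases subsingleton_or_nontrivial V with hsub | hnt
    · refine (Finset.sum_eq_zero fun u _ => Finset.sum_eq_zero fun v _ => ?_).trans_le zero_le
      rw [Subsingleton.elim u v, SimpleGraph.dist_self]
    -- Deleting a non-cut vertex `w` shortens no distance, and the row and column of `w` together
    -- contribute at most `n * (n + 1)`.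
    · obtain ⟨w, hw⟩ := hG.exists_connected_induce_compl_singleton_of_finite_nontrivial
      have hcard : Fintype.card ↑({w}ᶜ : Set V) = n := by
        rw [Fintype.card_compl_set, hV, Fintype.card_unique, Nat.add_sub_cancel]
      have hsplit : ∀ f : V → ℕ, ∑ u, f u = f w + ∑ u : ↑({w}ᶜ : Set V), f u := by
        intro f
        rw [Fintype.sum_eq_add_sum_compl w]
        congr 1
        exact Finset.sum_subtype _ (by simp) f
      have hw2 := two_mul_sum_dist_le hG w
      have hrow : ∑ u : ↑({w}ᶜ : Set V), G.dist u w = ∑ u, G.dist w u := by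
        rw [hsplit (fun u => G.dist w u), SimpleGraph.dist_self, zero_add]
        exact sum_congr rfl fun u _ => G.dist_comm
      have hind : ∑ u : ↑({w}ᶜ : Set V), ∑ v : ↑({w}ᶜ : Set V), G.dist u v ≤
          ∑ m ∈ range n, m * (m + 1) :=
        (sum_le_sum fun u _ => sum_le_sum fun v _ => dist_le_dist_induce hw u v).trans
          (ih hw hcard)
      rw [hsplit, sum_congr rfl fun u _ => hsplit _, sum_add_distrib, hrow, sum_range_succ]
      rw [hV, Nat.add_sub_cancel, mul_comm] at hw2
      lia

/-! ### The path graph -/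

section Path

lemma sub_le_dist_pathGraph {n : ℕ} (i j : Fin n) :
    (i : ℕ) - j + (j - i) ≤ (SimpleGraph.pathGraph n).dist i j := by
  obtain ⟨p, hp⟩ := (SimpleGraph.pathGraph_preconnected n i j).exists_walk_length_eq_dist
  rw [← hp]
  clear hp
  induction p with
  | nil => simp
  | cons h p ih =>
    rw [SimpleGraph.pathGraph_adj] at h
    rw [SimpleGraph.Walk.length_cons]
    lia

lemma sum_sum_sub_range (n : ℕ) :
    ∑ i ∈ range n, ∑ j ∈ range n, ((i - j) + (j - i)) = ∑ m ∈ range n, m * (m + 1) := by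
  induction n with
  | zero => simp
  | succ n ih =>
    have h : 2 * ∑ j ∈ range n, (n - j) = n * (n + 1) := by
      have := sum_range_id_mul_two (n + 1)
      rw [← sum_range_reflect, sum_range_succ] at this
      simp only [Nat.add_sub_cancel, Nat.sub_self] at this
      rw [Nat.mul_comm, mul_comm n, ← this, add_zero]
    rw [sum_range_succ, sum_congr rfl fun i _ => sum_range_succ _ n, sum_add_distrib, ih,
      sum_range_succ _ n, sum_range_succ _ n, ← h]
    have h1 : ∀ i ∈ range n, i - n + (n - i) = n - i := fun i hi => by
      have := mem_range.1 hi; lia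
    have h2 : ∀ i ∈ range n, n - i + (i - n) = n - i := fun i hi => by
      have := mem_range.1 hi; lia
    rw [sum_congr rfl h1, sum_congr rfl h2]
    lia

lemma le_sum_sum_dist_pathGraph (n : ℕ) :
    ∑ m ∈ range n, m * (m + 1) ≤ ∑ i, ∑ j, (SimpleGraph.pathGraph n).dist i j := by
  rw [← sum_sum_sub_range, ← Fin.sum_univ_eq_sum_range]
  refine sum_le_sum fun i _ => ?_
  rw [← Fin.sum_univ_eq_sum_range (fun j => (i : ℕ) - j + (j - i))]
  exact sum_le_sum fun j _ => sub_le_dist_pathGraph i j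

lemma isTree_pathGraph {n : ℕ} (hn : 0 < n) : (SimpleGraph.pathGraph n).IsTree := by
  obtain ⟨n, rfl⟩ := Nat.exists_eq_succ_of_ne_zero hn.ne'
  refine ⟨SimpleGraph.pathGraph_connected n, ?_⟩
  rw [SimpleGraph.isAcyclic_iff_forall_adj_isBridge]
  intro v w hvw
  rw [SimpleGraph.isBridge_iff]
  rintro ⟨p⟩
  -- Without the edge `vw`, no walk crosses the cut between labels up to `min v w` and the rest.
  have key : ∀ {x y : Fin (n + 1)},
      ((SimpleGraph.pathGraph (n + 1)).deleteEdges {s(v, w)}).Walk x y →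
        ((x : ℕ) ≤ min (v : ℕ) w ↔ (y : ℕ) ≤ min (v : ℕ) w) := by
    intro x y p
    induction p with
    | nil => rfl
    | cons h p ih =>
      rw [← ih]
      simp only [SimpleGraph.deleteEdges_adj, SimpleGraph.pathGraph_adj, Set.mem_singleton_iff,
        Sym2.eq_iff, Fin.ext_iff] at h
      rw [SimpleGraph.pathGraph_adj] at hvw
      lia
  have := key p
  rw [SimpleGraph.pathGraph_adj] at hvw
  lia

end Path

/-! ### Hitting times and Kemeny's constant of a tree -/

section TreeHittingTime

variable {V : Type*} [Fintype V] (T : SimpleGraph V) [DecidableRel T.Adj]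

/-- The expected hitting time of `j` from `i` for the simple random walk on the tree `T`. -/
noncomputable def treeHittingTime (i j : V) : ℝ :=
  ∑ k, T.degree k * ((T.dist i j : ℝ) + T.dist j k - T.dist i k) / 2

variable {T}

lemma treeHittingTime_nonneg (hT : T.IsTree) (i j : V) : 0 ≤ treeHittingTime T i j := by
  refine sum_nonneg fun k _ => div_nonneg (mul_nonneg (Nat.cast_nonneg _) ?_) zero_le_two
  have h : (T.dist i k : ℝ) ≤ T.dist i j + T.dist j k := by
    exact_mod_cast hT.connected.dist_triangle
  linarith

lemma treeHittingTime_self (j : V) : treeHittingTime T j j = 0 := by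
  simp [treeHittingTime]

/-- The Laplacians of the distances to `j` and to `k` cancel at `i`, except for a point source when
`k = i`; that source yields the `-1`. -/
lemma sum_neighborFinset_treeHittingTime (hT : T.IsTree) {i j : V} (hij : i ≠ j) :
    ∑ l ∈ T.neighborFinset i, treeHittingTime T l j =
      T.degree i * (treeHittingTime T i j - 1) := by
  classical
  have h : ∀ k, ∑ l ∈ T.neighborFinset i,
      (T.degree k : ℝ) * ((T.dist l j : ℝ) + T.dist j k - T.dist l k) / 2 =
        T.degree i * (T.degree k * ((T.dist i j : ℝ) + T.dist j k - T.dist i k) / 2) -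
          if k = i then (T.degree k : ℝ) else 0 := by
    intro k
    rw [← sum_div, ← mul_sum, sum_sub_distrib, sum_add_distrib,
      sum_neighborFinset_dist_cast hT, sum_neighborFinset_dist_cast hT, if_neg hij.symm, sum_const,
      SimpleGraph.card_neighborFinset_eq_degree, nsmul_eq_mul]
    split_ifs <;> ring
  simp only [treeHittingTime]
  rw [sum_comm, sum_congr rfl fun k _ => h k, sum_sub_distrib, ← mul_sum, sum_ite_eq',
    if_pos (mem_univ i)]
  ring

/-- Swapping `j` and `k` cancels both terms containing `i`, hence the independence of the starting
vertex. -/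
lemma sum_degree_mul_treeHittingTime (i : V) :
    ∑ j, (T.degree j : ℝ) * treeHittingTime T i j =
      (∑ j, ∑ k, (T.degree j : ℝ) * (T.degree k * T.dist k j)) / 2 := by
  have hsymm : ∑ j, ∑ k, (T.degree j : ℝ) * (T.degree k * T.dist i j) =
      ∑ j, ∑ k, (T.degree j : ℝ) * (T.degree k * T.dist i k) := by
    rw [sum_comm]
    exact sum_congr rfl fun j _ => sum_congr rfl fun k _ => by ring
  have h : ∀ j k, (T.degree j : ℝ) *
      (T.degree k * ((T.dist i j : ℝ) + T.dist j k - T.dist i k) / 2) =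
        (T.degree j * (T.degree k * T.dist i j) + T.degree j * (T.degree k * T.dist k j)
          - T.degree j * (T.degree k * T.dist i k)) / 2 := by
    intro j k
    rw [T.dist_comm (u := j)]
    ring
  simp only [treeHittingTime, mul_sum (univ : Finset V)]
  rw [sum_congr rfl fun j _ => sum_congr rfl fun k _ => h j k]
  simp only [← sum_div, sum_sub_distrib, sum_add_distrib, hsymm]
  ring

lemma hasGraphKemenyConstant_of_isTree [Nontrivial V] (hT : T.IsTree) :
    HasGraphKemenyConstant T
      ((∑ u, ∑ v, (T.dist u v : ℝ)) / (Fintype.card V - 1) - (2 * Fintype.card V - 1) / 2) := by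
  have hdeg : ∀ i, 0 < T.degree i := fun i =>
    hT.connected.preconnected.degree_pos_of_nontrivial i
  have hdeg' : ∀ i, (T.degree i : ℝ) ≠ 0 := fun i => Nat.cast_ne_zero.2 (hdeg i).ne'
  have hn : (0 : ℝ) < Fintype.card V - 1 := by
    have : (1 : ℝ) < Fintype.card V := by exact_mod_cast Fintype.one_lt_card (α := V)
    linarith
  have hcdef : ∀ i, ∑ j, T.degree j / (2 * ((Fintype.card V : ℝ) - 1)) * treeHittingTime T i j =
      (∑ u, ∑ v, (T.dist u v : ℝ)) / (Fintype.card V - 1) - (2 * Fintype.card V - 1) / 2 := by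
    intro i
    simp only [div_mul_eq_mul_div]
    rw [← sum_div, sum_degree_mul_treeHittingTime, sum_degree_mul_degree_mul_dist hT]
    simp only [T.dist_comm]
    field_simp
    ring
  have hπ0 : ∀ i, 0 ≤ T.degree i / (2 * ((Fintype.card V : ℝ) - 1)) := fun i => by positivity
  refine hasKemenyConstant_of_real (H := treeHittingTime T)
    (π := fun i => T.degree i / (2 * (Fintype.card V - 1))) hπ0 ?_ (fun k => ?_)
    (treeHittingTime_nonneg hT) treeHittingTime_self (fun i j hij => ?_) ?_ hcdef
  · rw [← sum_div, sum_degree_cast hT]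
    exact div_self (by positivity)
  · classical
    -- Stationarity is symmetry of adjacency tested on the indicator of `k`.
    have hs := sum_sum_neighborFinset T (fun _ => 1) (fun i => if i = k then 1 else 0)
    have hP : ∀ i, (randomWalk T i k).toReal =
        (∑ l ∈ T.neighborFinset i, if l = k then (1 : ℝ) else 0) / T.degree i := fun i => by
      rw [← sum_randomWalk_mul (hdeg i)]
      simp
    simp only [one_mul, sum_const, SimpleGraph.card_neighborFinset_eq_degree, nsmul_eq_mul,
      mul_one, ite_mul, zero_mul, sum_ite_eq', mem_univ, if_true] at hs
    rw [← hs, sum_div]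
    refine sum_congr rfl fun i _ => ?_
    rw [hP i]
    have := hdeg' i
    field_simp
    rw [sum_ite_eq']
  · rw [sum_randomWalk_mul (hdeg i), sum_neighborFinset_treeHittingTime hT hij,
      mul_div_cancel_left₀ _ (hdeg' i)]
    ring
  · obtain ⟨i⟩ := hT.connected.nonempty
    rw [← hcdef i]
    exact sum_nonneg fun j _ => mul_nonneg (hπ0 j) (treeHittingTime_nonneg hT i j)

end TreeHittingTime

lemma hasKemenyConstant_zero_of_unique {V : Type*} [Fintype V] [Unique V] (P : V → PMF V) :
    HasKemenyConstant P 0 := by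
  have hP : (P default default).toReal = 1 := by
    have h := (P default).tsum_coe
    rw [tsum_fintype, Fintype.sum_unique] at h
    rw [h, ENNReal.toReal_one]
  refine hasKemenyConstant_of_real (π := fun _ => 1) (H := fun _ _ => 0) (by simp) (by simp)
    (fun k => ?_) (by simp) (by simp) (fun i j hij => absurd (Subsingleton.elim i j) hij) le_rfl
    (by simp)
  rw [Fintype.sum_unique, Subsingleton.elim k default, hP, one_mul]

end Kemeny

theorem mainTheorem3 (n : ℕ) {V : Type*} [Fintype V] (T : SimpleGraph V) (hT : T.IsTree)
    (hn : Fintype.card V = n) :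
    (SimpleGraph.pathGraph n).IsTree ∧
      ∃ KT KP : ℝ, Kemeny.HasGraphKemenyConstant T KT ∧
        Kemeny.HasGraphKemenyConstant (SimpleGraph.pathGraph n) KP ∧ KT ≤ KP := by
  classical
  have := hT.connected.nonempty
  have hpos : 0 < n := hn ▸ Fintype.card_pos
  have hpath := Kemeny.isTree_pathGraph hpos
  refine ⟨hpath, ?_⟩
  -- One vertex is separate: the general formula would divide by `n - 1 = 0`.
  rcases (Nat.succ_le_of_lt hpos).eq_or_lt with rfl | h1
  · obtain ⟨_⟩ := Fintype.card_eq_one_iff_nonempty_unique.1 hn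
    exact ⟨0, 0, Kemeny.hasKemenyConstant_zero_of_unique _,
      Kemeny.hasKemenyConstant_zero_of_unique (V := Fin 1) _, le_rfl⟩
  · have : Nontrivial V := Fintype.one_lt_card_iff_nontrivial.1 (hn ▸ h1)
    have : Nontrivial (Fin n) := Fin.nontrivial_iff_two_le.2 h1
    refine ⟨_, _, Kemeny.hasGraphKemenyConstant_of_isTree hT,
      Kemeny.hasGraphKemenyConstant_of_isTree hpath, ?_⟩
    rw [hn, Fintype.card_fin]
    have hnn : (0 : ℝ) ≤ n - 1 := by
      have : (1 : ℝ) ≤ n := by exact_mod_cast hpos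
      linarith
    have hW : ∑ u, ∑ v, (T.dist u v : ℝ) ≤
        ∑ i, ∑ j, ((SimpleGraph.pathGraph n).dist i j : ℝ) := by
      exact_mod_cast (Kemeny.sum_sum_dist_le n hT.connected hn).trans
        (Kemeny.le_sum_sum_dist_pathGraph n)
    gcongr
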